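/- All Banach spaces are real. For a compact Hausdorff space $K$ and a Banach space $X$, let $C(K,X)$ be the Banach space of continuous functions $K\to X$ with the supremum norm, $C(K)=C(K,\mathbb{R})$, let $\ell_\infty(X)$ be the Banach space of bounded sequences in $X$ indexed by $\mathbb{N}$ with the supremum norm, and $\ell_\infty=\ell_\infty(\mathbb{R})$. For Banach spaces $X,Y$, write $X\hookrightarrow Y$ if there are a bounded linear operator $T:X\to Y$ and a constant $c>0$ with $c\|u\|\le\|T(u)\|$ for all $u\in X$, and write $X\sim Y$ if such a $T$ can be chosen surjective. Let $K$ be an infinite compact Hausdorff space. Then \[C(K,\ell_\infty)\sim\ell_\infty(C(K))\ \Longrightarrow\ \ell_\infty\hookrightarrow C(K).\] Consequently, if $K$ is an infinite compact metrizable space, then $C(K,\ell_\infty)\not\sim\ell_\infty(C(K))$. -/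

import Mathlib

/-- The Banach space `ℓ_∞(X)` of bounded sequences in `X`, with the supremum norm. -/
abbrev EllInfty (X : Type*) [NormedAddCommGroup X] : Type _ :=
  lp (fun _ : ℕ => X) (⊤ : ENNReal)

/-- `X ↪ Y`: there is a bounded linear operator `T : X → Y` that is bounded below,
`c ‖u‖ ≤ ‖T u‖` for some `c > 0` and all `u`. -/
def LinearlyEmbeds (X Y : Type*) [NormedAddCommGroup X] [NormedSpace ℝ X]
    [NormedAddCommGroup Y] [NormedSpace ℝ Y] : Prop :=
  ∃ (T : X →L[ℝ] Y) (c : ℝ), 0 < c ∧ ∀ u : X, c * ‖u‖ ≤ ‖T u‖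

/-- `X ∼ Y`: there is a bounded linear operator `T : X → Y` that is bounded below and
surjective. -/
def LinearlyIsomorphic (X Y : Type*) [NormedAddCommGroup X] [NormedSpace ℝ X]
    [NormedAddCommGroup Y] [NormedSpace ℝ Y] : Prop :=
  ∃ (T : X →L[ℝ] Y) (c : ℝ), 0 < c ∧ (∀ u : X, c * ‖u‖ ≤ ‖T u‖) ∧ Function.Surjective T

open Filter Topology

namespace EllInfty

/-! ### Coordinatewise operators and indicator sequences in `ℓ_∞`. -/

section Basic

/-! Put `X = C(K, ℓ_∞)` and suppose that `C(K)` contains no copy of `ℓ_∞`. Since `ℓ_∞(ℓ_∞(Z))` is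
`ℓ_∞(Z)`, the isomorphism makes `ℓ_∞(X)` complemented in `X`. Hence every sequence `y n` in the unit
ball gives an operator `U : ℓ_∞ → X` whose value at the indicator of `A` is sent by `P n` to `y n`
for each `n ∈ A`.

The contradiction comes from approximating this value `U 1_A` by `Q m (U 1_A)`, where `Q m` is a
finite sum of maps `F ↦ p ⊗ F t`. Rosenthal's theorem on operators `ℓ_∞ → C(K)` lets `A` be thinned
until `U 1_A` factors through the quotient of `K` determined by the functions `J k (y k)`; on such
functions `Q m` tends to the identity. So, for one large `m`, `μ n (P n (Q m (U 1_A)))` is near `μ n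
(y n) = 1` for all `n ∈ A`.

These numbers are nevertheless small for large `n ∈ A`. The part of `1_A` away from `n` and a finite
set is controlled by Rosenthal's lemma, and the finite part by weak* nullness of `μ n`. The term at
`n` is controlled by Phillips' lemma: the `y n` come from a weakly unconditionally Cauchy sequence,
and each `Q m` factors through finitely many copies of `ℓ_∞`. The pairs `(y n, μ n)` are built from
disjoint bumps on `K` and Rademacher sequences in `ℓ_∞`. -/

theorem norm_coord_le {X : Type*} [NormedAddCommGroup X] (a : EllInfty X) (n : ℕ) : ‖a n‖ ≤ ‖a‖ :=
  lp.norm_apply_le_norm ENNReal.top_ne_zero a n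

variable {E X : Type*} [NormedAddCommGroup E] [NormedSpace ℝ E]
  [NormedAddCommGroup X] [NormedSpace ℝ X]

/-- The operator into `ℓ_∞(X)` whose coordinates are the uniformly bounded operators `L n`. -/
noncomputable def ofCoord (L : ℕ → E →L[ℝ] X) (C : ℝ) (hL : ∀ n x, ‖L n x‖ ≤ C * ‖x‖) :
    E →L[ℝ] EllInfty X :=
  LinearMap.mkContinuous
    { toFun := fun x => ⟨fun n => L n x, memℓp_infty ⟨C * ‖x‖, by
        rintro _ ⟨n, rfl⟩
        exact hL n x⟩⟩
      map_add' := fun x y => by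
        apply lp.ext
        funext n
        exact (L n).map_add x y
      map_smul' := fun c x => by
        apply lp.ext
        funext n
        exact (L n).map_smul c x }
    |C| (fun x => by
      refine lp.norm_le_of_forall_le (by positivity) fun n => (hL n x).trans ?_
      gcongr
      exact le_abs_self C)

@[simp]
theorem ofCoord_apply (L : ℕ → E →L[ℝ] X) (C : ℝ) (hL : ∀ n x, ‖L n x‖ ≤ C * ‖x‖) (x : E)
    (n : ℕ) : ofCoord L C hL x n = L n x := rfl

/-- The operator sending a scalar sequence `a` to the sequence `a n • f n`. -/
noncomputable def diagonal (f : ℕ → X) (C : ℝ) (hf : ∀ n, ‖f n‖ ≤ C) :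
    EllInfty ℝ →L[ℝ] EllInfty X :=
  ofCoord (fun n => (lp.evalCLM ℝ (fun _ : ℕ => ℝ) ⊤ n).smulRight (f n)) C (fun n a => by
    change ‖a n • f n‖ ≤ _
    rw [norm_smul, mul_comm]
    exact mul_le_mul (hf n) (norm_coord_le a n) (norm_nonneg _) ((norm_nonneg _).trans (hf n)))

@[simp]
theorem diagonal_apply (f : ℕ → X) (C : ℝ) (hf : ∀ n, ‖f n‖ ≤ C) (a : EllInfty ℝ) (n : ℕ) :
    diagonal f C hf a n = a n • f n := rfl

open Classical in
/-- The operator sending `a` to the sequence which is `a (κ n)` for `n ∈ D` and zero elsewhere. -/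
noncomputable def pull (D : Set ℕ) (κ : ℕ → ℕ) : EllInfty ℝ →L[ℝ] EllInfty ℝ :=
  ofCoord (fun n => if n ∈ D then lp.evalCLM ℝ (fun _ : ℕ => ℝ) ⊤ (κ n) else 0) 1 (fun n a => by
    split_ifs
    · rw [one_mul]
      exact norm_coord_le a _
    · simp)

open Classical in
theorem pull_apply (D : Set ℕ) (κ : ℕ → ℕ) (a : EllInfty ℝ) (n : ℕ) :
    pull D κ a n = if n ∈ D then a (κ n) else 0 := by
  unfold pull
  rw [ofCoord_apply]
  split_ifs <;> rfl

theorem norm_pull_apply_le (D : Set ℕ) (κ : ℕ → ℕ) (a : EllInfty ℝ) : ‖pull D κ a‖ ≤ ‖a‖ := by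
  classical
  refine lp.norm_le_of_forall_le (norm_nonneg _) fun n => ?_
  rw [pull_apply]
  split_ifs
  · exact norm_coord_le a _
  · simp

/-- The indicator sequence of `A`. -/
noncomputable def ind (A : Set ℕ) : EllInfty ℝ := pull A id 1

open Classical in
theorem ind_apply (A : Set ℕ) (n : ℕ) : ind A n = if n ∈ A then 1 else 0 := by
  rw [ind, pull_apply]
  rfl

theorem norm_ind_le (A : Set ℕ) : ‖ind A‖ ≤ 1 := by
  classical
  refine lp.norm_le_of_forall_le zero_le_one fun n => ?_
  rw [ind_apply]
  split_ifs <;> simp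

theorem pull_id_ind (A B : Set ℕ) : pull A id (ind B) = ind (A ∩ B) := by
  classical
  apply lp.ext
  funext n
  rw [pull_apply, ind_apply, ind_apply]
  by_cases hA : n ∈ A <;> by_cases hB : n ∈ B <;> simp [hA, hB]

theorem ind_union {A B : Set ℕ} (h : Disjoint A B) : ind (A ∪ B) = ind A + ind B := by
  classical
  apply lp.ext
  funext n
  rw [lp.coeFn_add, Pi.add_apply, ind_apply, ind_apply, ind_apply]
  by_cases hA : n ∈ A
  · have hB : n ∉ B := fun hB => Set.disjoint_left.1 h hA hB
    simp [hA, hB]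
  · by_cases hB : n ∈ B <;> simp [hA, hB]

theorem ind_empty : ind ∅ = 0 := by
  classical
  apply lp.ext
  funext n
  rw [ind_apply]
  simp

theorem ind_finset (F : Finset ℕ) : ind (F : Set ℕ) = ∑ n ∈ F, ind {n} := by
  classical
  induction F using Finset.induction_on with
  | empty => simpa using ind_empty
  | insert k F hk ih =>
    rw [Finset.sum_insert hk, ← ih, ← ind_union (by simpa using hk), Finset.coe_insert,
      Set.insert_eq]

open Classical in
theorem ind_eq_ind_diff_add (A : Set ℕ) (F : Finset ℕ) :
    ind A = ind (A \ F) + ∑ k ∈ F with k ∈ A, ind {k} := by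
  rw [← ind_finset, ← ind_union]
  · congr 1
    ext k
    by_cases hk : k ∈ F <;> simp [hk]
  · rw [Set.disjoint_left]
    rintro k ⟨-, hk⟩ hk'
    simp only [Finset.coe_filter, Set.mem_ofPred_eq] at hk'
    exact hk hk'.1

theorem diagonal_ind_singleton (f : ℕ → X) (C : ℝ) (hf : ∀ n, ‖f n‖ ≤ C) (n : ℕ) :
    diagonal f C hf (ind {n}) = lp.single ⊤ n (f n) := by
  classical
  apply lp.ext
  funext k
  rw [diagonal_apply, ind_apply]
  by_cases h : k = n
  · subst h
    simp
  · simp [h]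

end Basic

/-! ### Restrictions of a functional on `ℓ_∞` to sets of indices. -/

section Restriction

/-- Disjointly supported vectors of the unit ball add up to a vector of the unit ball, so both
restrictions can be tested at once. This superadditivity is the key input to Rosenthal's lemma. -/
theorem norm_comp_pull_id_add_le (ρ : EllInfty ℝ →L[ℝ] ℝ) {s t : Set ℕ} (h : Disjoint s t) :
    ‖ρ.comp (pull s id)‖ + ‖ρ.comp (pull t id)‖ ≤ ‖ρ.comp (pull (s ∪ t) id)‖ := by
  classical
  have key : ∀ a b : EllInfty ℝ, ‖a‖ ≤ 1 → ‖b‖ ≤ 1 →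
      ρ (pull s id a) + ρ (pull t id b) ≤ ‖ρ.comp (pull (s ∪ t) id)‖ := by
    intro a b ha hb
    have hc : ‖pull s id a + pull t id b‖ ≤ 1 := by
      refine lp.norm_le_of_forall_le zero_le_one fun n => ?_
      rw [lp.coeFn_add, Pi.add_apply, pull_apply, pull_apply]
      by_cases hs : n ∈ s
      · have ht : n ∉ t := fun ht => Set.disjoint_left.1 h hs ht
        simpa [hs, ht] using (norm_coord_le a n).trans ha
      · by_cases ht : n ∈ t
        · simpa [hs, ht] using (norm_coord_le b n).trans hb
        · simp [hs, ht]
    have he : pull (s ∪ t) id (pull s id a + pull t id b) = pull s id a + pull t id b := by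
      apply lp.ext
      funext n
      by_cases hs : n ∈ s <;> by_cases ht : n ∈ t <;> simp [pull_apply, hs, ht]
    calc ρ (pull s id a) + ρ (pull t id b)
        = (ρ.comp (pull (s ∪ t) id)) (pull s id a + pull t id b) := by
          rw [ContinuousLinearMap.comp_apply, he, map_add]
      _ ≤ ‖(ρ.comp (pull (s ∪ t) id)) (pull s id a + pull t id b)‖ := Real.le_norm_self _
      _ ≤ ‖ρ.comp (pull (s ∪ t) id)‖ * 1 := ContinuousLinearMap.le_of_opNorm_le_of_le _ le_rfl hc
      _ = _ := mul_one _
  have abs_le : ∀ (η : EllInfty ℝ →L[ℝ] ℝ) (M : ℝ), (∀ a, ‖a‖ ≤ 1 → η a ≤ M) → ‖η‖ ≤ M := by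
    intro η M hM
    refine η.opNorm_le_of_unit_norm (by simpa using hM 0 (by simp)) fun a ha => ?_
    rw [Real.norm_eq_abs, abs_le']
    exact ⟨hM a ha.le, by simpa using hM (-a) (by simpa using ha.le)⟩
  rw [← le_sub_iff_add_le]
  refine abs_le _ _ fun a ha => ?_
  rw [le_sub_comm]
  refine abs_le _ _ fun b hb => ?_
  have := key a b ha hb
  rw [ContinuousLinearMap.comp_apply, ContinuousLinearMap.comp_apply]
  linarith

theorem norm_comp_pull_id_le (ρ : EllInfty ℝ →L[ℝ] ℝ) (s : Set ℕ) :
    ‖ρ.comp (pull s id)‖ ≤ ‖ρ‖ := by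
  refine ContinuousLinearMap.opNorm_le_bound _ (norm_nonneg _) fun a => ?_
  rw [ContinuousLinearMap.comp_apply]
  exact ContinuousLinearMap.le_of_opNorm_le_of_le _ le_rfl (norm_pull_apply_le _ _ _)

theorem norm_comp_pull_id_mono (ρ : EllInfty ℝ →L[ℝ] ℝ) {s t : Set ℕ} (h : s ⊆ t) :
    ‖ρ.comp (pull s id)‖ ≤ ‖ρ.comp (pull t id)‖ := by
  have := norm_comp_pull_id_add_le ρ (Set.disjoint_sdiff_right (s := s) (t := t))
  rw [Set.union_sdiff_cancel h] at this
  linarith [norm_nonneg (ρ.comp (pull (t \ s) id))]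

end Restriction

/-! ### Selection of infinite sets: Rosenthal's lemma and diagonalization. -/

section Combinatorics

theorem exists_infinite_partition {M : Set ℕ} (hM : M.Infinite) :
    ∃ P : ℕ → Set ℕ, (∀ p, (P p).Infinite) ∧ (∀ p, P p ⊆ M) ∧
      Pairwise (Function.onFun Disjoint P) := by
  let e : ℕ ↪ M := hM.natEmbedding
  refine ⟨fun p => Set.range fun q => (e (Nat.pair p q) : ℕ), fun p => ?_, fun p => ?_, ?_⟩
  · refine Set.infinite_range_of_injective fun q r h => ?_
    have := e.injective (Subtype.ext h)
    simpa using this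
  · rintro _ ⟨q, rfl⟩
    exact (e _).2
  · intro p p' hpp
    rw [Function.onFun, Set.disjoint_left]
    rintro _ ⟨q, rfl⟩ ⟨r, h⟩
    have := e.injective (Subtype.ext h)
    simp at this
    exact hpp this.1.symm

/-- Rosenthal's lemma. -/
theorem exists_infinite_offDiagonal_le {N : ℕ → Set ℕ → ℝ} (h0 : ∀ k s, 0 ≤ N k s)
    (hadd : ∀ k s t, Disjoint s t → N k s + N k t ≤ N k (s ∪ t)) {C : ℝ} (hC : ∀ k s, N k s ≤ C)
    {ε : ℝ} (hε : 0 < ε) {M : Set ℕ} (hM : M.Infinite) :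
    ∃ A ⊆ M, A.Infinite ∧ ∀ k ∈ A, N k (A \ {k}) ≤ ε := by
  have mono : ∀ k s t, s ⊆ t → N k s ≤ N k t := by
    intro k s t h
    have := hadd k s (t \ s) Set.disjoint_sdiff_right
    rw [Set.union_sdiff_cancel h] at this
    linarith [h0 k (t \ s)]
  -- Induction on the number of `ε`'s bounding the off-diagonal mass: each failure to find a good
  -- set lowers that bound by one `ε`.
  have step : ∀ j : ℕ, ∀ M : Set ℕ, M.Infinite → (∀ k ∈ M, N k (M \ {k}) ≤ j * ε) →
      ∃ A ⊆ M, A.Infinite ∧ ∀ k ∈ A, N k (A \ {k}) ≤ ε := by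
    intro j
    induction j with
    | zero =>
      intro M hM h
      exact ⟨M, subset_rfl, hM, fun k hk => (h k hk).trans (by simpa using hε.le)⟩
    | succ j ih =>
      intro M hM h
      obtain ⟨P, hPi, hPM, hPd⟩ := exists_infinite_partition hM
      by_cases hgood : ∃ p, ∀ k ∈ P p, N k (P p \ {k}) ≤ ε
      · obtain ⟨p, hp⟩ := hgood
        exact ⟨P p, hPM p, hPi p, hp⟩
      · push Not at hgood
        choose k hk hkε using hgood
        have hkinj : Function.Injective k := by
          intro p q hpq
          by_contra hne
          exact Set.disjoint_left.1 (hPd hne) (hk p) (hpq ▸ hk q)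
        have hsub : Set.range k ⊆ M := by
          rintro _ ⟨p, rfl⟩
          exact hPM p (hk p)
        obtain ⟨A, hA, hAi, hAε⟩ := ih (Set.range k) (Set.infinite_range_of_injective hkinj) (by
          rintro _ ⟨p, rfl⟩
          -- The transversal `range k` meets the block `P p` only in `k p`. The block already
          -- carries mass more than `ε`, which superadditivity takes away from the transversal.
          have hd : Disjoint (Set.range k \ {k p}) (P p \ {k p}) := by
            rw [Set.disjoint_left]
            rintro _ ⟨⟨q, rfl⟩, hq⟩ ⟨hq', -⟩
            have hne : q ≠ p := fun h => hq (by rw [h]; rfl)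
            exact Set.disjoint_left.1 (hPd hne) (hk q) hq'
          have h1 := hadd (k p) _ _ hd
          have h2 : N (k p) (Set.range k \ {k p} ∪ P p \ {k p}) ≤ N (k p) (M \ {k p}) := by
            refine mono _ _ _ (Set.union_subset ?_ ?_)
            · exact Set.sdiff_subset_sdiff_left hsub
            · exact Set.sdiff_subset_sdiff_left (hPM p)
          have h3 := h (k p) (hsub ⟨p, rfl⟩)
          have h4 := hkε p
          push_cast at h3
          linarith)
        exact ⟨A, hA.trans hsub, hAi, hAε⟩
  obtain ⟨j, hj⟩ := exists_nat_ge (C / ε)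
  exact step j M hM fun k _ => (hC _ _).trans ((div_le_iff₀ hε).1 hj)

theorem exists_infinite_norm_comp_pull_le {ρ : ℕ → EllInfty ℝ →L[ℝ] ℝ} {C : ℝ}
    (hC : ∀ k, ‖ρ k‖ ≤ C) {ε : ℝ} (hε : 0 < ε) {M : Set ℕ} (hM : M.Infinite) :
    ∃ A ⊆ M, A.Infinite ∧ ∀ k ∈ A, ‖(ρ k).comp (pull (A \ {k}) id)‖ ≤ ε :=
  exists_infinite_offDiagonal_le (N := fun k s => ‖(ρ k).comp (pull s id)‖)
    (fun _ _ => norm_nonneg _) (fun k _ _ h => norm_comp_pull_id_add_le (ρ k) h)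
    (fun k s => (norm_comp_pull_id_le (ρ k) s).trans (hC k)) hε hM

/-- Countably many hereditary and dense properties of infinite sets of natural numbers hold
simultaneously for some infinite set, up to finite modifications. -/
theorem exists_infinite_forall_diff_finite {ι : Type*} [Countable ι] [Nonempty ι]
    {Φ : ι → Set ℕ → Prop}
    (hered : ∀ c A B, B ⊆ A → Φ c A → Φ c B)
    (dense : ∀ c (M : Set ℕ), M.Infinite → ∃ A ⊆ M, A.Infinite ∧ Φ c A) :
    ∃ A : Set ℕ, A.Infinite ∧ ∀ c, ∃ F : Finset ℕ, Φ c (A \ F) := by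
  choose! R hRsub hRinf hRΦ using dense
  obtain ⟨e, he⟩ := exists_surjective_nat ι
  let S : ℕ → Set ℕ := fun c => Nat.rec (R (e 0) Set.univ) (fun c A => R (e (c + 1)) A) c
  have hSinf : ∀ c, (S c).Infinite := by
    intro c
    induction c with
    | zero => exact hRinf (e 0) _ Set.infinite_univ
    | succ c ih => exact hRinf (e (c + 1)) _ ih
  have hSΦ : ∀ c, Φ (e c) (S c) := by
    intro c
    cases c with
    | zero => exact hRΦ (e 0) _ Set.infinite_univ
    | succ c => exact hRΦ (e (c + 1)) _ (hSinf c)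
  have hSanti : Antitone S := antitone_nat_of_succ_le fun c => hRsub (e (c + 1)) _ (hSinf c)
  -- A pseudo-intersection of the decreasing sets `S c`: all but the first `c` of its elements lie
  -- in `S c`.
  obtain ⟨φ, hφ, hφS⟩ := extraction_forall_of_frequently (P := fun c n => n ∈ S c)
    (fun c => Nat.frequently_atTop_iff_infinite.2 (hSinf c))
  refine ⟨Set.range φ, Set.infinite_range_of_injective hφ.injective, fun i => ?_⟩
  obtain ⟨c, rfl⟩ := he i
  refine ⟨(Finset.range c).image φ, hered (e c) _ _ ?_ (hSΦ c)⟩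
  rintro _ ⟨⟨j, rfl⟩, hj⟩
  have : c ≤ j := by
    by_contra hlt
    exact hj (by
      rw [Finset.coe_image]
      exact ⟨j, by simpa using hlt, rfl⟩)
  exact hSanti this (hφS j)

end Combinatorics

end EllInfty

namespace EllInfty

/-! ### Rosenthal's theorem on operators from `ℓ_∞`. -/

section Embedding

/-- Rosenthal's theorem: an operator on `ℓ_∞` that does not tend to zero along a sequence of
disjoint indicators fixes a copy of `ℓ_∞`. -/
theorem linearlyEmbeds_of_le_norm_ind {Z : Type*} [NormedAddCommGroup Z] [NormedSpace ℝ Z]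
    (U : EllInfty ℝ →L[ℝ] Z) {B : ℕ → Set ℕ} (hB : Pairwise (Function.onFun Disjoint B))
    {ε : ℝ} (hε : 0 < ε) (hU : ∀ k, ε ≤ ‖U (ind (B k))‖) : LinearlyEmbeds (EllInfty ℝ) Z := by
  classical
  have hex : ∀ n, ∃ k, ∀ j, n ∈ B j → j = k := by
    intro n
    by_cases h : ∃ k, n ∈ B k
    · obtain ⟨k, hk⟩ := h
      refine ⟨k, fun j hj => ?_⟩
      by_contra hne
      exact Set.disjoint_left.1 (hB hne) hj hk
    · exact ⟨0, fun j hj => absurd ⟨j, hj⟩ h⟩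
  choose κ hκ using hex
  -- Spreading the `k`-th coordinate over the block `B k` reduces to the case of singletons.
  let W : EllInfty ℝ →L[ℝ] Z := U.comp (pull (⋃ k, B k) κ)
  have hW : ∀ k, W (ind {k}) = U (ind (B k)) := by
    intro k
    suffices h : pull (⋃ k, B k) κ (ind {k}) = ind (B k) from congrArg U h
    apply lp.ext
    funext n
    rw [pull_apply, ind_apply, ind_apply]
    by_cases hn : n ∈ B k
    · simp [hn, ← hκ n k hn, Set.mem_iUnion.2 ⟨k, hn⟩]
    · rw [if_neg hn]
      split_ifs with h1 h2
      · obtain ⟨j, hj⟩ := Set.mem_iUnion.1 h1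
        rw [← hκ n j hj] at h2
        exact absurd (h2 ▸ hj) hn
      · rfl
      · rfl
  choose z hz1 hz using fun k => exists_dual_vector'' ℝ (W (ind {k}))
  let ρ : ℕ → EllInfty ℝ →L[ℝ] ℝ := fun k => (z k).comp W
  have hρ : ∀ k, ‖ρ k‖ ≤ ‖W‖ := fun k =>
    ((z k).opNorm_comp_le W).trans (mul_le_of_le_one_left (norm_nonneg _) (hz1 k))
  have hρk : ∀ k, ε ≤ ρ k (ind {k}) := by
    intro k
    change ε ≤ z k (W (ind {k}))
    rw [hz k, hW k]
    exact hU k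
  obtain ⟨A, -, hAi, hA⟩ := exists_infinite_norm_comp_pull_le hρ (half_pos hε) Set.infinite_univ
  let φ : ℕ → ℕ := Nat.nth (· ∈ A)
  have hφA : ∀ j, φ j ∈ A := Nat.nth_mem_of_infinite hAi
  have hφinj : Function.Injective φ := Nat.nth_injective hAi
  -- The sequence is transported to the coordinates in `A`. There the diagonal contributes at least
  -- `ε |a j|` and the rest at most `ε / 2 * ‖a‖`, which leaves the constant `ε / 2`.
  refine ⟨W.comp (pull A (Function.invFun φ)), ε / 2, half_pos hε, fun a => ?_⟩
  rw [ContinuousLinearMap.comp_apply]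
  obtain ⟨b, hb⟩ : ∃ b : EllInfty ℝ, b = pull A (Function.invFun φ) a := ⟨_, rfl⟩
  rw [← hb]
  have hbn : ‖b‖ ≤ ‖a‖ := hb ▸ norm_pull_apply_le _ _ _
  have hbφ : ∀ j, b (φ j) = a j := by
    intro j
    rw [hb, pull_apply, if_pos (hφA j), Function.leftInverse_invFun hφinj]
  have hdec : ∀ j, b = a j • ind {φ j} + pull (A \ {φ j}) id b := by
    intro j
    apply lp.ext
    funext n
    rw [lp.coeFn_add, Pi.add_apply, lp.coeFn_smul, Pi.smul_apply, ind_apply, pull_apply]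
    by_cases hn : n = φ j
    · simp [hn, hbφ]
    · by_cases hnA : n ∈ A
      · simp [hn, hnA]
      · have h0 : b n = 0 := by rw [hb, pull_apply, if_neg hnA]
        simp [hn, hnA, h0]
  have hlow : ∀ j, |a j| * ε ≤ ‖W b‖ + ε / 2 * ‖a‖ := by
    intro j
    have h1 : ρ (φ j) b = a j * ρ (φ j) (ind {φ j}) +
        (ρ (φ j)).comp (pull (A \ {φ j}) id) b := by
      conv_lhs => rw [hdec j, map_add, map_smul, smul_eq_mul]
      rfl
    have h2 : |(ρ (φ j)).comp (pull (A \ {φ j}) id) b| ≤ ε / 2 * ‖a‖ :=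
      ContinuousLinearMap.le_of_opNorm_le_of_le _ (hA _ (hφA j)) hbn
    have h3 : |ρ (φ j) b| ≤ ‖W b‖ := by
      have := ContinuousLinearMap.le_of_opNorm_le (z (φ j)) (hz1 (φ j)) (W b)
      rwa [one_mul] at this
    have h4 : |a j| * ε ≤ |a j * ρ (φ j) (ind {φ j})| := by
      rw [abs_mul]
      exact mul_le_mul_of_nonneg_left ((hρk _).trans (le_abs_self _)) (abs_nonneg _)
    have h5 : a j * ρ (φ j) (ind {φ j}) =
        ρ (φ j) b - (ρ (φ j)).comp (pull (A \ {φ j}) id) b := by linarith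
    rw [h5] at h4
    linarith [abs_sub (ρ (φ j) b) ((ρ (φ j)).comp (pull (A \ {φ j}) id) b)]
  have hsup : ‖a‖ ≤ (‖W b‖ + ε / 2 * ‖a‖) / ε := by
    refine lp.norm_le_of_forall_le (by positivity) fun j => ?_
    rw [le_div_iff₀ hε]
    exact hlow j
  rw [le_div_iff₀ hε] at hsup
  linarith

end Embedding

/-! ### Phillips' lemma and weakly unconditionally Cauchy series. -/

section Phillips

/-- Phillips' lemma along the diagonal. -/
theorem tendsto_apply_ind_singleton {ρ : ℕ → EllInfty ℝ →L[ℝ] ℝ} {C : ℝ} (hC : ∀ i, ‖ρ i‖ ≤ C)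
    (hρ : ∀ a, Tendsto (fun i => ρ i a) atTop (𝓝 0)) :
    Tendsto (fun i => ρ i (ind {i})) atTop (𝓝 0) := by
  rw [Metric.tendsto_atTop]
  by_contra! h
  obtain ⟨ε, hε, h⟩ := h
  have hM : {i | ε ≤ |ρ i (ind {i})|}.Infinite := by
    rw [← Nat.frequently_atTop_iff_infinite, frequently_atTop]
    intro N
    obtain ⟨n, hn, hn'⟩ := h N
    exact ⟨n, hn, by simpa using hn'⟩
  -- With off-diagonal mass at most `ε / 2`, the single vector `ind A` keeps `|ρ i (ind A)| ≥ ε / 2`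
  -- for all `i ∈ A`, against pointwise convergence.
  obtain ⟨A, hAM, hAi, hA⟩ := exists_infinite_norm_comp_pull_le hC (half_pos hε) hM
  have hlow : ∀ i ∈ A, ε / 2 ≤ |ρ i (ind A)| := by
    intro i hi
    have hdec : ind A = ind {i} + pull (A \ {i}) id (ind (A \ {i})) := by
      rw [pull_id_ind, Set.inter_self, ← ind_union Set.disjoint_sdiff_right, Set.union_sdiff_cancel]
      simpa using hi
    have h1 : ρ i (ind A) = ρ i (ind {i}) + (ρ i).comp (pull (A \ {i}) id) (ind (A \ {i})) := by
      conv_lhs => rw [hdec, map_add]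
      rfl
    have h2 : |(ρ i).comp (pull (A \ {i}) id) (ind (A \ {i}))| ≤ ε / 2 * 1 :=
      ContinuousLinearMap.le_of_opNorm_le_of_le _ (hA i hi) (norm_ind_le _)
    have h3 : ε ≤ |ρ i (ind {i})| := hAM hi
    have h4 := abs_sub (ρ i (ind A)) ((ρ i).comp (pull (A \ {i}) id) (ind (A \ {i})))
    rw [show ρ i (ind A) - (ρ i).comp (pull (A \ {i}) id) (ind (A \ {i})) = ρ i (ind {i}) by
      linarith] at h4
    linarith
  obtain ⟨N, hN⟩ := Metric.tendsto_atTop.1 (hρ (ind A)) (ε / 2) (half_pos hε)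
  obtain ⟨i, hi, hiN⟩ := hAi.exists_gt N
  have := hN i hiN.le
  rw [Real.dist_eq, sub_zero] at this
  exact absurd (hlow i hi) (not_le.2 this)

variable {X : Type*} [NormedAddCommGroup X] [NormedSpace ℝ X]

/-- The sums of a weakly unconditionally Cauchy series, tested against a functional. -/
theorem exists_functional_extension {f : ℕ → X} {C : ℝ}
    (hf : ∀ (s : Finset ℕ) (c : ℕ → ℝ), (∀ i, |c i| ≤ 1) → ‖∑ i ∈ s, c i • f i‖ ≤ C)
    (φ : X →L[ℝ] ℝ) :
    ∃ ψ : EllInfty ℝ →L[ℝ] ℝ, ‖ψ‖ ≤ ‖φ‖ * C ∧ ∀ i, ψ (ind {i}) = φ (f i) := by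
  classical
  have hC : 0 ≤ C := (norm_nonneg _).trans (hf ∅ 0 (by simp))
  have hsum : ∀ s : Finset ℕ, ∑ i ∈ s, |φ (f i)| ≤ ‖φ‖ * C := by
    intro s
    have h1 : ∑ i ∈ s, |φ (f i)| = φ (∑ i ∈ s, (SignType.sign (φ (f i)) : ℝ) • f i) := by
      simp only [map_sum, map_smul, smul_eq_mul, sign_mul_self]
    rw [h1]
    refine (le_abs_self _).trans (ContinuousLinearMap.le_of_opNorm_le_of_le φ le_rfl (hf s _ ?_))
    intro i
    rcases SignType.sign (φ (f i)) with _ | _ | _ <;> simp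
  have hs : Summable fun i => |φ (f i)| := summable_of_sum_le (fun _ => abs_nonneg _) hsum
  have hle : ∀ (a : EllInfty ℝ) i, ‖a i * φ (f i)‖ ≤ ‖a‖ * |φ (f i)| := fun a i => by
    rw [norm_mul]
    exact mul_le_mul_of_nonneg_right (norm_coord_le a i) (abs_nonneg _)
  have hsa : ∀ a : EllInfty ℝ, Summable fun i => a i * φ (f i) := fun a =>
    Summable.of_norm_bounded (hs.mul_left ‖a‖) (hle a)
  let ψ : EllInfty ℝ →ₗ[ℝ] ℝ :=
    { toFun := fun a => ∑' i, a i * φ (f i)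
      map_add' := fun a b => by
        rw [← (hsa a).tsum_add (hsa b)]
        exact tsum_congr fun i => add_mul _ _ _
      map_smul' := fun c a => by
        rw [RingHom.id_apply, smul_eq_mul, ← tsum_mul_left]
        exact tsum_congr fun i => mul_assoc _ _ _ }
  refine ⟨ψ.mkContinuous (‖φ‖ * C) fun a => ?_, LinearMap.mkContinuous_norm_le _ (by positivity) _,
    fun i => ?_⟩
  · change ‖∑' i, a i * φ (f i)‖ ≤ _
    refine (tsum_of_norm_bounded (hs.mul_left ‖a‖).hasSum (hle a)).trans ?_
    rw [tsum_mul_left, mul_comm]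
    exact mul_le_mul_of_nonneg_right (Real.tsum_le_of_sum_le (fun _ => abs_nonneg _) hsum)
      (norm_nonneg _)
  · change ∑' k, ind {i} k * φ (f k) = _
    rw [tsum_eq_single i fun k hk => by simp [ind_apply, hk]]
    simp [ind_apply]

/-- Functionals on `X` which factor through a fixed operator into `ℓ_∞`, weak* null on `ℓ_∞`,
tend to zero along the terms of a weakly unconditionally Cauchy series. -/
theorem tendsto_comp_apply_of_wuc {f : ℕ → X} {C : ℝ}
    (hf : ∀ (s : Finset ℕ) (c : ℕ → ℝ), (∀ i, |c i| ≤ 1) → ‖∑ i ∈ s, c i • f i‖ ≤ C)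
    (α : X →L[ℝ] EllInfty ℝ) {β : ℕ → EllInfty ℝ →L[ℝ] ℝ} {D : ℝ} (hD : ∀ i, ‖β i‖ ≤ D)
    (hβ : ∀ a, Tendsto (fun i => β i a) atTop (𝓝 0)) :
    Tendsto (fun i => β i (α (f i))) atTop (𝓝 0) := by
  choose ψ hψ hψf using fun l =>
    exists_functional_extension hf ((lp.evalCLM ℝ (fun _ : ℕ => ℝ) ⊤ l).comp α)
  have hC : 0 ≤ C := (norm_nonneg _).trans (hf ∅ 0 (by simp))
  have hev : ∀ l, ‖(lp.evalCLM ℝ (fun _ : ℕ => ℝ) ⊤ l).comp α‖ ≤ ‖α‖ := fun l =>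
    ContinuousLinearMap.opNorm_le_bound _ (norm_nonneg _) fun x =>
      (norm_coord_le (α x) l).trans (α.le_opNorm x)
  -- Although `∑ a i • α (f i)` need not converge in norm, each of its coordinates converges
  -- absolutely; these coordinate sums define `V`.
  let V : EllInfty ℝ →L[ℝ] EllInfty ℝ := ofCoord ψ (‖α‖ * C) fun l a =>
    ContinuousLinearMap.le_of_opNorm_le _
      ((hψ l).trans (mul_le_mul_of_nonneg_right (hev l) hC)) a
  have hV : ∀ i, V (ind {i}) = α (f i) := by
    intro i
    apply lp.ext
    funext l
    exact hψf l i
  have := tendsto_apply_ind_singleton (ρ := fun i => (β i).comp V) (C := D * ‖V‖)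
    (fun i => ((β i).opNorm_comp_le V).trans (mul_le_mul_of_nonneg_right (hD i) (norm_nonneg _)))
    (fun a => hβ (V a))
  simpa only [ContinuousLinearMap.comp_apply, hV] using this

end Phillips

end EllInfty

namespace EllInfty

/-! ### Rademacher sequences and a weak* null sequence on `ℓ_∞`. -/

section Orthonormal

/-- The Rademacher sequence `ω ↦ (-1) ^ (i-th binary digit of ω)`. -/
def rademacher (i ω : ℕ) : ℝ := if ω.testBit i then -1 else 1

theorem rademacher_mul_self (i ω : ℕ) : rademacher i ω * rademacher i ω = 1 := by
  unfold rademacher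
  split_ifs <;> norm_num

theorem abs_rademacher (i ω : ℕ) : |rademacher i ω| = 1 := by
  unfold rademacher
  split_ifs <;> norm_num

/-- Flipping the `i`-th bit is an involution of `[0, 2 ^ N)` that changes the sign of one factor
only. -/
theorem sum_rademacher_mul {i j N : ℕ} (hij : i ≠ j) (hi : i < N) :
    ∑ ω ∈ Finset.range (2 ^ N), rademacher i ω * rademacher j ω = 0 := by
  have hflip : ∀ ω, rademacher i (ω ^^^ 2 ^ i) = -rademacher i ω := by
    intro ω
    unfold rademacher
    rw [Nat.testBit_xor, Nat.testBit_two_pow_self]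
    cases ω.testBit i <;> simp
  have hkeep : ∀ ω, rademacher j (ω ^^^ 2 ^ i) = rademacher j ω := by
    intro ω
    unfold rademacher
    rw [Nat.testBit_xor, Nat.testBit_two_pow_of_ne hij]
    simp
  refine Finset.sum_involution (fun ω _ => ω ^^^ 2 ^ i) ?_ ?_ ?_ ?_
  · intro ω _
    rw [hflip, hkeep]
    ring
  · intro ω _ _ h
    have := hflip ω
    rw [h] at this
    have h1 := rademacher_mul_self i ω
    have h2 : rademacher i ω = 0 := by linarith
    rw [h2] at h1
    norm_num at h1
  · intro ω hω
    rw [Finset.mem_range] at hω ⊢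
    exact Nat.xor_lt_two_pow hω (Nat.pow_lt_pow_right one_lt_two hi)
  · intro ω _
    simp

/-- A positive normalized functional on `ℓ_∞` for which the Rademacher sequences are orthonormal. -/
theorem exists_mean : ∃ Λ : EllInfty ℝ →ₗ[ℝ] ℝ, (∀ a : EllInfty ℝ, (∀ n, 0 ≤ a n) → 0 ≤ Λ a) ∧
    ∀ (a : EllInfty ℝ) (c : ℝ) (N₀ : ℕ),
      (∀ N > N₀, ∑ ω ∈ Finset.range (2 ^ N), a ω = 2 ^ N * c) → Λ a = c := by
  -- The functional is an ultrafilter limit of averages over dyadic initial segments; for products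
  -- of Rademacher sequences these averages are eventually constant.
  let avg : EllInfty ℝ → ℕ → ℝ := fun a N => (∑ ω ∈ Finset.range (2 ^ N), a ω) / 2 ^ N
  let 𝒰 : Ultrafilter ℕ := hyperfilter ℕ
  have hlim : ∀ a : EllInfty ℝ, ∃ x, Tendsto (avg a) 𝒰 (𝓝 x) := by
    intro a
    have hmem : ∀ N, avg a N ∈ Metric.closedBall (0 : ℝ) ‖a‖ := by
      intro N
      rw [mem_closedBall_zero_iff, norm_div, div_le_iff₀ (norm_pos_iff.2 (by positivity))]
      refine (norm_sum_le_of_le _ fun ω _ => norm_coord_le a ω).trans ?_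
      simp [mul_comm]
    obtain ⟨x, -, hx⟩ := (isCompact_closedBall (0 : ℝ) ‖a‖).ultrafilter_le_nhds (𝒰.map (avg a))
      (by
        rw [le_principal_iff, Ultrafilter.mem_coe, Ultrafilter.mem_map]
        exact Filter.univ_mem' hmem)
    exact ⟨x, hx⟩
  choose Λ hΛ using hlim
  refine ⟨{ toFun := Λ, map_add' := fun a b => ?_, map_smul' := fun c a => ?_ },
    fun a ha => ?_, fun a c N₀ h => ?_⟩
  · refine tendsto_nhds_unique (hΛ (a + b)) (((hΛ a).add (hΛ b)).congr fun N => ?_)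
    simp only [avg]
    rw [← add_div, ← Finset.sum_add_distrib]
    rfl
  · refine tendsto_nhds_unique (hΛ (c • a)) (((hΛ a).const_mul c).congr fun N => ?_)
    simp only [avg]
    rw [← mul_div_assoc, Finset.mul_sum]
    rfl
  · exact ge_of_tendsto' (hΛ a) fun N =>
      div_nonneg (Finset.sum_nonneg fun ω _ => ha ω) (by positivity)
  · refine tendsto_nhds_unique (hΛ a) (tendsto_const_nhds.congr' ?_)
    have hev : ∀ᶠ N in atTop, c = avg a N := by
      filter_upwards [eventually_gt_atTop N₀] with N hN
      simp only [avg]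
      rw [h N hN, mul_div_cancel_left₀]
      positivity
    exact Nat.hyperfilter_le_atTop hev

/-- A bounded sequence in `ℓ_∞` which is norming for a weak* null sequence of functionals. -/
theorem exists_weakStar_null : ∃ (u : ℕ → EllInfty ℝ) (θ : ℕ → EllInfty ℝ →L[ℝ] ℝ),
    (∀ i, ‖u i‖ ≤ 1) ∧ (∀ i, ‖θ i‖ ≤ 1) ∧ (∀ i, θ i (u i) = 1) ∧
      ∀ a, Tendsto (fun i => θ i a) atTop (𝓝 0) := by
  obtain ⟨Λ, hpos, hΛ⟩ := exists_mean
  have hone : Λ 1 = 1 := hΛ 1 1 0 fun N _ => by simp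
  have hmono : ∀ a b : EllInfty ℝ, (∀ n, a n ≤ b n) → Λ a ≤ Λ b := by
    intro a b h
    have := hpos (b - a) fun n => by simpa using h n
    rw [map_sub] at this
    linarith
  have hbound : ∀ a : EllInfty ℝ, ‖Λ a‖ ≤ ‖a‖ := by
    intro a
    have h1 : Λ (‖a‖ • 1) = ‖a‖ := by rw [map_smul, hone, smul_eq_mul, mul_one]
    rw [Real.norm_eq_abs, abs_le]
    constructor
    · have := hmono ((-‖a‖) • 1) a fun n => by
        change -‖a‖ * 1 ≤ a n
        rw [mul_one]
        exact (abs_le.1 (norm_coord_le a n)).1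
      rwa [map_smul, hone, smul_eq_mul, mul_one] at this
    · have := hmono a (‖a‖ • 1) fun n => by
        simpa using (abs_le.1 (norm_coord_le a n)).2
      rwa [h1] at this
  let u : ℕ → EllInfty ℝ := fun i => ⟨rademacher i, memℓp_infty ⟨1, by
    rintro _ ⟨n, rfl⟩
    exact (abs_rademacher i n).le⟩⟩
  have hu : ∀ i, ‖u i‖ ≤ 1 := fun i =>
    lp.norm_le_of_forall_le zero_le_one fun n => (abs_rademacher i n).le
  have huu : ∀ i, Λ (u i * u i) = 1 := fun i => hΛ _ _ 0 fun N _ => by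
    simp [u, rademacher_mul_self]
  have huv : ∀ i j, i ≠ j → Λ (u i * u j) = 0 := fun i j hij => hΛ _ _ i fun N hN => by
    simpa [u] using sum_rademacher_mul hij hN
  -- Bessel's inequality for the semi-inner product `Λ (a * b)`. It makes the coefficients `Λ (u i *
  -- a)` square summable, hence null.
  have hbessel : ∀ (a : EllInfty ℝ) (s : Finset ℕ), ∑ i ∈ s, Λ (u i * a) ^ 2 ≤ Λ (a * a) := by
    intro a s
    set b : EllInfty ℝ := ∑ i ∈ s, Λ (u i * a) • u i with hb
    have h0 : 0 ≤ Λ ((a - b) * (a - b)) := hpos _ fun n => mul_self_nonneg ((a - b) n)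
    have h1 : Λ (b * a) = ∑ i ∈ s, Λ (u i * a) ^ 2 := by
      simp only [hb, Finset.sum_mul, map_sum, smul_mul_assoc, map_smul, smul_eq_mul, sq]
    have h2 : Λ (b * b) = ∑ i ∈ s, Λ (u i * a) ^ 2 := by
      conv_lhs => rw [hb]
      simp only [Finset.sum_mul, Finset.mul_sum, map_sum, smul_mul_assoc, mul_smul_comm, map_smul,
        smul_eq_mul, sq]
      refine Finset.sum_congr rfl fun i hi => ?_
      rw [Finset.sum_eq_single i]
      · rw [huu, mul_one]
      · intro j _ hj
        rw [huv j i hj]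
        simp
      · exact fun h => absurd hi h
    rw [show (a - b) * (a - b) = a * a - b * a - b * a + b * b by ring, map_add, map_sub, map_sub]
      at h0
    linarith
  refine ⟨u, fun i => (Λ ∘ₗ LinearMap.mulLeft ℝ (u i)).mkContinuous 1 fun a => ?_, hu,
    fun i => LinearMap.mkContinuous_norm_le _ zero_le_one _, huu, fun a => ?_⟩
  · refine (hbound _).trans ((norm_mul_le _ _).trans ?_)
    exact mul_le_mul_of_nonneg_right (hu i) (norm_nonneg _)
  · have hs : Summable fun i => Λ (u i * a) ^ 2 :=
      summable_of_sum_le (fun _ => sq_nonneg _) (hbessel a)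
    have := hs.tendsto_atTop_zero
    change Tendsto (fun i => Λ (u i * a)) atTop (𝓝 0)
    rw [tendsto_zero_iff_abs_tendsto_zero]
    simpa [Real.sqrt_sq_eq_abs, Function.comp_def] using this.sqrt

end Orthonormal

end EllInfty

namespace ContinuousMap

/-! ### Bumps, norming pairs and approximation in `C(K, E)`. -/

section Compact

variable {K E : Type*} [TopologicalSpace K] [CompactSpace K] [NormedAddCommGroup E]
  [NormedSpace ℝ E]

/-- The operator `v ↦ p ⊗ v` from `E` into `C(K, E)`. -/
noncomputable def tensor (p : C(K, ℝ)) : E →L[ℝ] C(K, E) :=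
  LinearMap.mkContinuous
    { toFun := fun v => ⟨fun t => p t • v, by fun_prop⟩
      map_add' := fun v w => by
        ext t
        simp
      map_smul' := fun c v => by
        ext t
        exact smul_comm _ _ _ }
    ‖p‖ (fun v => by
      refine (ContinuousMap.norm_le _ (by positivity)).2 fun t => ?_
      change ‖p t • v‖ ≤ _
      rw [norm_smul]
      exact mul_le_mul_of_nonneg_right (p.norm_coe_le_norm t) (norm_nonneg v))

@[simp]
theorem tensor_apply (p : C(K, ℝ)) (v : E) (t : K) : tensor p v t = p t • v := rfl

/-- An infinite compact Hausdorff space carries a sequence of disjointly supported bumps. -/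
theorem exists_disjoint_bumps (K : Type*) [TopologicalSpace K] [CompactSpace K] [T2Space K]
    [Infinite K] : ∃ (g : ℕ → C(K, ℝ)) (t : ℕ → K), (∀ i, g i (t i) = 1) ∧
      (∀ i s, |g i s| ≤ 1) ∧ ∀ i j s, i ≠ j → g i s = 0 ∨ g j s = 0 := by
  obtain ⟨V, hVi, hVo, hVd⟩ := exists_seq_infinite_isOpen_pairwise_disjoint K
  choose t ht using fun i => (hVi i).nonempty
  have hex : ∀ i, ∃ g : C(K, ℝ), Set.EqOn g 0 (V i)ᶜ ∧ Set.EqOn g 1 {t i} ∧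
      ∀ s, g s ∈ Set.Icc (0 : ℝ) 1 := fun i =>
    exists_continuous_zero_one_of_isClosed (hVo i).isClosed_compl isClosed_singleton
      (Set.disjoint_singleton_right.2 fun h => h (ht i))
  choose g hg0 hg1 hg using hex
  refine ⟨g, t, fun i => hg1 i rfl, fun i s => ?_, fun i j s hij => ?_⟩
  · rw [abs_of_nonneg (hg i s).1]
    exact (hg i s).2
  · by_cases h : s ∈ V i
    · exact Or.inr (hg0 j (Set.disjoint_left.1 (hVd hij) h))
    · exact Or.inl (hg0 i h)

/-- A weakly unconditionally Cauchy sequence in `C(K, ℓ_∞)` which is norming for a weak* null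
sequence of functionals. -/
theorem exists_wuc_weakStar_null (K : Type*) [TopologicalSpace K] [CompactSpace K] [T2Space K]
    [Infinite K] :
    ∃ (f : ℕ → C(K, EllInfty ℝ)) (μ : ℕ → C(K, EllInfty ℝ) →L[ℝ] ℝ),
      (∀ (s : Finset ℕ) (c : ℕ → ℝ), (∀ i, |c i| ≤ 1) → ‖∑ i ∈ s, c i • f i‖ ≤ 1) ∧
      (∀ i, ‖μ i‖ ≤ 1) ∧ (∀ i, μ i (f i) = 1) ∧
      ∀ F, Tendsto (fun i => μ i F) atTop (𝓝 0) := by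
  obtain ⟨g, t, hgt, hg, hgd⟩ := exists_disjoint_bumps K
  obtain ⟨u, θ, hu, hθ, hθu, hθ0⟩ := EllInfty.exists_weakStar_null
  refine ⟨fun i => tensor (g i) (u i), fun i => (θ i).comp (ContinuousMap.evalCLM ℝ (t i)),
    fun s c hc => ?_, fun i => ?_, fun i => ?_, fun F => ?_⟩
  · refine (ContinuousMap.norm_le _ zero_le_one).2 fun r => ?_
    rw [ContinuousMap.sum_apply]
    have hterm : ∀ i, ‖(c i • tensor (g i) (u i)) r‖ ≤ 1 := by
      intro i
      rw [ContinuousMap.smul_apply, tensor_apply, norm_smul, norm_smul]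
      exact mul_le_one₀ (hc i) (by positivity)
        (mul_le_one₀ (hg i r) (norm_nonneg _) (hu i))
    by_cases h : ∃ i ∈ s, g i r ≠ 0
    · obtain ⟨i, hi, hir⟩ := h
      rw [Finset.sum_eq_single i]
      · exact hterm i
      · intro j _ hj
        have : g j r = 0 := (hgd j i r hj).resolve_right hir
        simp [this]
      · exact fun h => absurd hi h
    · push Not at h
      rw [Finset.sum_eq_zero fun i hi => by simp [h i hi]]
      simp
  · refine ContinuousLinearMap.opNorm_le_bound _ zero_le_one fun F => ?_
    rw [one_mul]
    have := ContinuousLinearMap.le_of_opNorm_le (θ i) (hθ i) (F (t i))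
    rw [one_mul] at this
    exact this.trans (F.norm_coe_le_norm _)
  · change θ i (g i (t i) • u i) = 1
    rw [hgt, one_smul, hθu]
  · rw [Metric.tendsto_atTop]
    intro ε hε
    -- The points `t i` vary with `i`, so convergence is needed uniformly on the compact range of
    -- `F`; a finite net and `‖θ i‖ ≤ 1` provide it.
    have htb : TotallyBounded (Set.range F) := (isCompact_range F.continuous).totallyBounded
    obtain ⟨y, hy, hcov⟩ := Metric.totallyBounded_iff.1 htb (ε / 2) (half_pos hε)
    have hev : ∀ᶠ i in atTop, ∀ v ∈ y, |θ i v| < ε / 2 := by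
      rw [eventually_all_finite hy]
      intro v _
      have := (hθ0 v).abs
      rw [abs_zero] at this
      exact this.eventually_lt_const (half_pos hε)
    obtain ⟨N, hN⟩ := eventually_atTop.1 hev
    refine ⟨N, fun i hi => ?_⟩
    obtain ⟨v, hv, hFv⟩ := Set.mem_iUnion₂.1 (hcov ⟨t i, rfl⟩)
    rw [mem_ball_iff_norm] at hFv
    have h1 := ContinuousLinearMap.le_of_opNorm_le (θ i) (hθ i) (F (t i) - v)
    rw [one_mul, map_sub] at h1
    have h2 := hN i hi v hv
    rw [Real.dist_eq, sub_zero]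
    change |θ i (F (t i))| < ε
    have h3 := abs_add_le (θ i (F (t i)) - θ i v) (θ i v)
    rw [sub_add_cancel] at h3
    rw [Real.norm_eq_abs] at h1
    linarith

theorem exists_partition_subordinate [T2Space K] {V : K → Set K} (hVo : ∀ t, IsOpen (V t))
    (hV : ∀ t, t ∈ V t) :
    ∃ (n : ℕ) (p : Fin n → C(K, ℝ)) (t : Fin n → K), (∀ j s, 0 ≤ p j s) ∧
      (∀ s, ∑ j, p j s = 1) ∧ ∀ j s, p j s ≠ 0 → s ∈ V (t j) := by
  obtain ⟨T, hT⟩ := isCompact_univ.elim_finite_subcover V hVo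
    fun s _ => Set.mem_iUnion.2 ⟨s, hV s⟩
  obtain ⟨p, hp, hp1, hp0, -⟩ := exists_continuous_sum_one_of_isOpen_isCompact
    (s := fun j : Fin T.card => V (T.equivFin.symm j)) (fun j => hVo _)
    (isCompact_univ (X := K)) (fun s hs => by
      obtain ⟨t, ht, hst⟩ := Set.mem_iUnion₂.1 (hT hs)
      exact Set.mem_iUnion.2 ⟨T.equivFin ⟨t, ht⟩, by simpa using hst⟩)
  refine ⟨T.card, p, fun j => T.equivFin.symm j, fun j s => (hp0 j s).1, fun s => ?_,
    fun j s h => hp j (subset_tsupport _ h)⟩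
  simpa using hp1 (Set.mem_univ s)

/-- Given a sequence in `C(K, E)`, there are contractions of `C(K, E)`, each of them a finite sum of
operators `F ↦ p ⊗ F t`, that converge to the identity on all functions that identify the points of
`K` identified by the sequence. -/
theorem exists_approximation [T2Space K] (x : ℕ → C(K, E)) :
    ∃ Q : ℕ → C(K, E) →L[ℝ] C(K, E), (∀ m, ‖Q m‖ ≤ 1) ∧
      (∀ m, ∃ (n : ℕ) (p : Fin n → C(K, ℝ)) (t : Fin n → K),
        ∀ F, Q m F = ∑ j, tensor (p j) (F (t j))) ∧
      ∀ F : C(K, E), (∀ s t, (∀ k, x k s = x k t) → F s = F t) →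
        Tendsto (fun m => Q m F) atTop (𝓝 F) := by
  have hpart : ∀ m : ℕ, ∃ (n : ℕ) (p : Fin n → C(K, ℝ)) (t : Fin n → K), (∀ j s, 0 ≤ p j s) ∧
      (∀ s, ∑ j, p j s = 1) ∧
      ∀ j s, p j s ≠ 0 → ∀ k < m, ‖x k s - x k (t j)‖ < 1 / ((m : ℝ) + 1) := by
    intro m
    obtain ⟨n, p, t, hp0, hp1, hp⟩ := exists_partition_subordinate
      (V := fun t => ⋂ k ∈ Finset.range m, {s | ‖x k s - x k t‖ < 1 / ((m : ℝ) + 1)})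
      (fun t => isOpen_biInter_finset fun k _ => isOpen_lt (by fun_prop) continuous_const)
      (fun t => Set.mem_iInter₂.2 fun k _ => by
        change ‖x k t - x k t‖ < _
        rw [sub_self, norm_zero]
        positivity)
    exact ⟨n, p, t, hp0, hp1, fun j s h k hk =>
      Set.mem_iInter₂.1 (hp j s h) k (Finset.mem_range.2 hk)⟩
  choose n p t hp0 hp1 hp using hpart
  let Q : ℕ → C(K, E) →L[ℝ] C(K, E) := fun m =>
    ∑ j, (tensor (p m j)).comp (ContinuousMap.evalCLM ℝ (t m j))
  have hQ : ∀ m F, Q m F = ∑ j, tensor (p m j) (F (t m j)) := by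
    intro m F
    simp only [Q, _root_.sum_apply]
    rfl
  have hQs : ∀ m F s, Q m F s = ∑ j, p m j s • F (t m j) := by
    intro m F s
    rw [hQ, ContinuousMap.sum_apply]
    rfl
  have hconv : ∀ m s (c : Fin (n m) → E) (δ : ℝ), (∀ j, p m j s ≠ 0 → ‖c j‖ ≤ δ) →
      ‖∑ j, p m j s • c j‖ ≤ δ := by
    intro m s c δ h
    calc ‖∑ j, p m j s • c j‖ ≤ ∑ j, p m j s * δ := norm_sum_le_of_le _ fun j _ => by
          rw [norm_smul, Real.norm_of_nonneg (hp0 m j s)]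
          by_cases h0 : p m j s = 0
          · simp [h0]
          · exact mul_le_mul_of_nonneg_left (h j h0) (hp0 m j s)
      _ = δ := by rw [← Finset.sum_mul, hp1, one_mul]
  refine ⟨Q, fun m => ?_, fun m => ⟨n m, p m, t m, hQ m⟩, fun F hF => ?_⟩
  · refine ContinuousLinearMap.opNorm_le_bound _ zero_le_one fun F => ?_
    rw [one_mul]
    refine (ContinuousMap.norm_le _ (norm_nonneg _)).2 fun s => ?_
    rw [hQs]
    exact hconv m s _ _ fun j _ => F.norm_coe_le_norm _
  -- Compactness of `K × K`: pairs on which `F` differs by at least `ε` form a closed set, and a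
  -- pair in all the nested `S m` would be identified by every `x k` but not by `F`.
  · have hunif : ∀ ε > 0, ∃ M : ℕ, ∀ m ≥ M, ∀ s t,
        (∀ k < m, ‖x k s - x k t‖ < 1 / ((m : ℝ) + 1)) → ‖F s - F t‖ < ε := by
      intro ε hε
      let S : ℕ → Set (K × K) := fun m => {z | ε ≤ ‖F z.1 - F z.2‖} ∩
        ⋂ k ∈ Finset.range m, {z | ‖x k z.1 - x k z.2‖ ≤ 1 / ((m : ℝ) + 1)}
      have hSc : ∀ m, IsClosed (S m) := fun m =>
        (isClosed_le continuous_const (by fun_prop)).inter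
          (isClosed_biInter fun k _ => isClosed_le (by fun_prop) continuous_const)
      have hSanti : ∀ m, S (m + 1) ⊆ S m := by
        rintro m z ⟨hz, hz'⟩
        refine ⟨hz, Set.mem_iInter₂.2 fun k hk => ?_⟩
        have h1 := Set.mem_iInter₂.1 hz' k
          (Finset.mem_range.2 ((Finset.mem_range.1 hk).trans (Nat.lt_succ_self m)))
        refine le_trans (show ‖x k z.1 - x k z.2‖ ≤ _ from h1) ?_
        push_cast
        gcongr
        linarith
      have hempty : ∃ M, S M = ∅ := by
        by_contra! hne
        obtain ⟨z, hz⟩ := IsCompact.nonempty_iInter_of_sequence_nonempty_isCompact_isClosed S hSanti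
          hne (hSc 0).isCompact hSc
        rw [Set.mem_iInter] at hz
        have heq : F z.1 = F z.2 := by
          refine hF _ _ fun k => ?_
          rw [← sub_eq_zero, ← norm_eq_zero]
          refine le_antisymm ?_ (norm_nonneg _)
          refine ge_of_tendsto tendsto_one_div_add_atTop_nhds_zero_nat ?_
          filter_upwards [eventually_gt_atTop k] with m hm
          exact Set.mem_iInter₂.1 (hz m).2 k (Finset.mem_range.2 hm)
        have := (hz 0).1
        rw [Set.mem_ofPred_eq, heq, sub_self, norm_zero] at this
        exact absurd this (not_le.2 hε)
      obtain ⟨M, hM⟩ := hempty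
      refine ⟨M, fun m hm s t h => ?_⟩
      by_contra hlt
      have hmem : (s, t) ∈ S m :=
        ⟨not_lt.1 hlt, Set.mem_iInter₂.2 fun k hk => (h k (Finset.mem_range.1 hk)).le⟩
      have := antitone_nat_of_succ_le hSanti hm hmem
      rw [hM] at this
      exact this
    rw [Metric.tendsto_atTop]
    intro ε hε
    obtain ⟨M, hM⟩ := hunif (ε / 2) (half_pos hε)
    refine ⟨M, fun m hm => ?_⟩
    rw [dist_eq_norm]
    refine lt_of_le_of_lt ((ContinuousMap.norm_le _ (half_pos hε).le).2 fun s => ?_)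
      (half_lt_self hε)
    have : (Q m F - F) s = ∑ j, p m j s • (F (t m j) - F s) := by
      simp only [ContinuousMap.sub_apply, hQs, smul_sub, Finset.sum_sub_distrib]
      rw [← Finset.sum_smul, hp1, one_smul]
    rw [this]
    refine hconv m s _ _ fun j hj => ?_
    rw [norm_sub_rev]
    exact (hM m hm s (t m j) (hp m j s hj)).le

end Compact

end ContinuousMap

/-! ### Diagonal operators from the identity `ℓ_∞(ℓ_∞(Z)) = ℓ_∞(Z)`. -/

section Isomorphism

variable {X Z : Type*} [NormedAddCommGroup X] [NormedSpace ℝ X] [NormedAddCommGroup Z]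
  [NormedSpace ℝ Z]

/-- If `X ∼ ℓ_∞(Z)`, then `ℓ_∞(X)` is isomorphic to a complemented subspace of `X`: there are
coordinate operators `P n` on `X`, and every bounded sequence `f` in `X` gives rise to an operator
from `ℓ_∞` to `X` whose values `x` satisfy `P n x = a n • f n`. -/
theorem LinearlyIsomorphic.exists_diagonal_operators (h : LinearlyIsomorphic X (EllInfty Z)) :
    ∃ (J P : ℕ → X →L[ℝ] X) (D : ℝ), (∀ n, ‖P n‖ ≤ D) ∧
      ∀ f : ℕ → X, (∀ n, ‖f n‖ ≤ 1) → ∃ U : EllInfty ℝ →L[ℝ] X,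
        (∀ n, U (EllInfty.ind {n}) = J n (f n)) ∧ ∀ n a, P n (U a) = a n • f n := by
  obtain ⟨T, c, hc, hT, hsurj⟩ := h
  have hinj : Function.Injective T := by
    rw [injective_iff_map_eq_zero]
    intro u hu
    have := hT u
    rw [hu, norm_zero] at this
    exact norm_le_zero_iff.1 (nonpos_of_mul_nonpos_right this hc)
  let e : X ≃L[ℝ] EllInfty Z :=
    (LinearEquiv.ofBijective T.toLinearMap ⟨hinj, hsurj⟩).toContinuousLinearEquivOfBounds
      ‖T‖ c⁻¹ (fun x => T.le_opNorm x) (fun y => by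
        obtain ⟨x, rfl⟩ := (LinearEquiv.ofBijective T.toLinearMap ⟨hinj, hsurj⟩).surjective y
        rw [LinearEquiv.symm_apply_apply, ← div_eq_inv_mul, le_div_iff₀ hc, mul_comm]
        exact hT x)
  have he : ∀ x, ‖e x‖ ≤ ‖T‖ * ‖x‖ := fun x => T.le_opNorm x
  let S : EllInfty Z →L[ℝ] X := e.symm
  -- `T` is applied in each coordinate, and the resulting double sequence is flattened by the
  -- pairing function; `part n` recovers its `n`-th row.
  let merge : EllInfty X →L[ℝ] EllInfty Z := EllInfty.ofCoord
    (fun q => ((lp.evalCLM ℝ (fun _ : ℕ => Z) ⊤ q.unpair.2).comp T).comp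
      (lp.evalCLM ℝ (fun _ : ℕ => X) ⊤ q.unpair.1)) ‖T‖ (fun q F =>
        (EllInfty.norm_coord_le (T (F q.unpair.1)) _).trans
          (ContinuousLinearMap.le_of_opNorm_le_of_le T le_rfl (EllInfty.norm_coord_le F _)))
  let part : ℕ → EllInfty Z →L[ℝ] EllInfty Z := fun n => EllInfty.ofCoord
    (fun q => lp.evalCLM ℝ (fun _ : ℕ => Z) ⊤ (Nat.pair n q)) 1 (fun q z => by
      rw [one_mul]
      exact EllInfty.norm_coord_le z _)
  have hpart : ∀ n z, ‖part n z‖ ≤ ‖z‖ := fun n z =>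
    lp.norm_le_of_forall_le (norm_nonneg _) fun q => EllInfty.norm_coord_le z _
  refine ⟨fun n => (S.comp merge).comp (lp.singleContinuousLinearMap ℝ (fun _ : ℕ => X) ⊤ n),
    fun n => S.comp ((part n).comp T), ‖S‖ * ‖T‖, fun n => ?_,
    fun f hf => ⟨(S.comp merge).comp (EllInfty.diagonal f 1 hf), fun n => ?_, fun n a => ?_⟩⟩
  · refine ContinuousLinearMap.opNorm_le_bound _ (by positivity) fun x => ?_
    rw [mul_assoc]
    exact ContinuousLinearMap.le_of_opNorm_le_of_le S le_rfl ((hpart n _).trans (T.le_opNorm x))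
  · exact congrArg (fun F => S (merge F)) (EllInfty.diagonal_ind_singleton f 1 hf n)
  · set F := EllInfty.diagonal f 1 hf a
    have h1 : T (S (merge F)) = merge F := e.apply_symm_apply _
    have h2 : part n (merge F) = T (F n) := by
      apply lp.ext
      funext q
      change T (F (Nat.pair n q).unpair.1) (Nat.pair n q).unpair.2 = _
      rw [Nat.unpair_pair]
    change S (part n (T (S (merge F)))) = F n
    rw [h1, h2]
    exact e.symm_apply_apply _

end Isomorphism

/-! ### Adapted pairs, the contradiction, and the separable case. -/

section Main

open ContinuousMap

/-- If `U : ℓ_∞ → C(K, ℓ_∞)` is an operator and `C(K)` contains no copy of `ℓ_∞`, then for any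
coordinate `l` every infinite set has an infinite subset on which the coordinate of `U` varies
little on a set of pairs of points. -/
theorem exists_infinite_subset_oscillation_le {K : Type*} [TopologicalSpace K] [CompactSpace K]
    (hK : ¬ LinearlyEmbeds (EllInfty ℝ) C(K, ℝ)) (U : EllInfty ℝ →L[ℝ] C(K, EllInfty ℝ))
    (R : K → K → Prop) (l : ℕ) {ε : ℝ} (hε : 0 < ε) {M : Set ℕ} (hM : M.Infinite) :
    ∃ A ⊆ M, A.Infinite ∧ ∀ B ⊆ A, ∀ s t, R s t →
      |U (EllInfty.ind B) s l - U (EllInfty.ind B) t l| ≤ ε := by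
  by_contra! h
  obtain ⟨P, hPi, hPM, hPd⟩ := EllInfty.exists_infinite_partition hM
  -- Each block of a partition of `M` contains a bad set. An oscillation above `ε` forces norm at
  -- least `ε / 2`, so these disjoint sets would yield a copy of `ℓ_∞` in `C(K)`.
  choose B hBP s t _ hst using fun q => h (P q) (hPM q) (hPi q)
  let Ul : EllInfty ℝ →L[ℝ] C(K, ℝ) :=
    ((lp.evalCLM ℝ (fun _ : ℕ => ℝ) ⊤ l).compLeftContinuous ℝ K).comp U
  refine hK (EllInfty.linearlyEmbeds_of_le_norm_ind Ul (B := B)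
    (fun p q hpq => (hPd hpq).mono (hBP p) (hBP q)) (half_pos hε) fun q => ?_)
  have h1 : |U (EllInfty.ind (B q)) (s q) l| ≤ ‖Ul (EllInfty.ind (B q))‖ :=
    (Ul (EllInfty.ind (B q))).norm_coe_le_norm (s q)
  have h2 : |U (EllInfty.ind (B q)) (t q) l| ≤ ‖Ul (EllInfty.ind (B q))‖ :=
    (Ul (EllInfty.ind (B q))).norm_coe_le_norm (t q)
  have h3 := abs_sub (U (EllInfty.ind (B q)) (s q) l) (U (EllInfty.ind (B q)) (t q) l)
  linarith [hst q]

/-- For operators `P n` and `J n` on `C(K, ℓ_∞)`, there are norming pairs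
`(y n, μ n)` and operators `Q m` such that the functionals `μ n ∘ P n ∘ Q m` are small on the
functions `J k (y k)` and on `J n (y n)`, and `Q m F → F` whenever `F` identifies the points
identified by all `J k (y k)`. -/
theorem exists_adapted_pairs (K : Type*) [TopologicalSpace K] [CompactSpace K] [T2Space K]
    [Infinite K] (J P : ℕ → C(K, EllInfty ℝ) →L[ℝ] C(K, EllInfty ℝ)) :
    ∃ (y : ℕ → C(K, EllInfty ℝ)) (μ : ℕ → C(K, EllInfty ℝ) →L[ℝ] ℝ)
      (Q : ℕ → C(K, EllInfty ℝ) →L[ℝ] C(K, EllInfty ℝ)),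
      (∀ n, ‖y n‖ ≤ 1) ∧ (∀ n, ‖μ n‖ ≤ 1) ∧ (∀ n, μ n (y n) = 1) ∧ (∀ m, ‖Q m‖ ≤ 1) ∧
      (∀ F : C(K, EllInfty ℝ), (∀ s t, (∀ k, J k (y k) s = J k (y k) t) → F s = F t) →
        Tendsto (fun m => Q m F) atTop (𝓝 F)) ∧
      (∀ m k, Tendsto (fun n => μ n (P n (Q m (J k (y k))))) atTop (𝓝 0)) ∧
      ∀ m, Tendsto (fun n => μ n (P n (Q m (J n (y n))))) atTop (𝓝 0) := by
  obtain ⟨f, μ, hf, hμ, hμf, hμ0⟩ := exists_wuc_weakStar_null K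
  let x : ℕ → ℕ → C(K, EllInfty ℝ) := fun n i => J n (f i)
  -- The operators `Q m` are adapted to the whole double sequence `J n (f i)`, so that they are
  -- fixed before the indices `ι n` are chosen.
  obtain ⟨Q, hQ1, hQfin, hQlim⟩ :=
    exists_approximation fun k : ℕ => x k.unpair.1 k.unpair.2
  have hdiag : ∀ n m, Tendsto (fun i => μ i (P n (Q m (x n i)))) atTop (𝓝 0) := by
    intro n m
    obtain ⟨N, p, t, hN⟩ := hQfin m
    simp only [hN, map_sum]
    rw [← Finset.sum_const_zero (s := (Finset.univ : Finset (Fin N)))]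
    refine tendsto_finsetSum _ fun j _ => ?_
    exact EllInfty.tendsto_comp_apply_of_wuc hf
      ((ContinuousMap.evalCLM ℝ (t j)).comp (J n))
      (β := fun i => (μ i).comp ((P n).comp (tensor (p j))))
      (D := 1 * ‖(P n).comp (tensor (p j))‖)
      (fun i => ((μ i).opNorm_comp_le _).trans
        (mul_le_mul_of_nonneg_right (hμ i) (ContinuousLinearMap.opNorm_nonneg _)))
      (fun a => hμ0 _)
  have hchoice : ∀ n : ℕ, ∃ i, (∀ m ≤ n, ∀ k ≤ n, ∀ r ≤ n,
      |μ i (P n (Q m (x k r)))| < 1 / ((n : ℝ) + 1)) ∧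
      ∀ m ≤ n, |μ i (P n (Q m (x n i)))| < 1 / ((n : ℝ) + 1) := by
    intro n
    have hpos : (0 : ℝ) < 1 / ((n : ℝ) + 1) := by positivity
    have small : ∀ {v : ℕ → ℝ}, Tendsto v atTop (𝓝 0) →
        ∀ᶠ i in atTop, |v i| < 1 / ((n : ℝ) + 1) := fun {v} hv => by
      have := hv.abs
      rw [abs_zero] at this
      exact this.eventually_lt_const hpos
    have fin := Set.finite_Iic n
    refine Eventually.exists (f := atTop) (Eventually.and ?_ ?_)
    · exact (eventually_all_finite fin).2 fun m _ => (eventually_all_finite fin).2 fun k _ =>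
        (eventually_all_finite fin).2 fun r _ => small (hμ0 _)
    · exact (eventually_all_finite fin).2 fun m _ => small (hdiag n m)
  choose ι hι hι' using hchoice
  refine ⟨fun n => f (ι n), fun n => μ (ι n), Q, fun n => by simpa using hf {ι n} 1 (by simp),
    fun n => hμ _, fun n => hμf _, hQ1, fun F hF => hQlim F fun s t h => hF s t fun k => ?_,
    fun m k => ?_, fun m => ?_⟩
  · simpa only [Nat.unpair_pair] using h (Nat.pair k (ι k))
  · refine squeeze_zero_norm' ?_ tendsto_one_div_add_atTop_nhds_zero_nat
    filter_upwards [eventually_ge_atTop (max m (max k (ι k)))] with n hn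
    simp only [max_le_iff] at hn
    exact (hι n m hn.1 k hn.2.1 (ι k) hn.2.2).le
  · refine squeeze_zero_norm' ?_ tendsto_one_div_add_atTop_nhds_zero_nat
    filter_upwards [eventually_ge_atTop m] with n hn
    exact (hι' n m hn).le

/-- If `ℓ_∞(C(K, ℓ_∞))` is complemented in `C(K, ℓ_∞)`, then `C(K)` contains a copy of `ℓ_∞`. -/
theorem linearlyEmbeds_of_diagonal_operators {K : Type*} [TopologicalSpace K] [CompactSpace K]
    [T2Space K] [Infinite K] (J P : ℕ → C(K, EllInfty ℝ) →L[ℝ] C(K, EllInfty ℝ)) {D : ℝ}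
    (hPD : ∀ n, ‖P n‖ ≤ D)
    (hJP : ∀ f : ℕ → C(K, EllInfty ℝ), (∀ n, ‖f n‖ ≤ 1) →
      ∃ U : EllInfty ℝ →L[ℝ] C(K, EllInfty ℝ),
        (∀ n, U (EllInfty.ind {n}) = J n (f n)) ∧ ∀ n a, P n (U a) = a n • f n) :
    LinearlyEmbeds (EllInfty ℝ) C(K, ℝ) := by
  classical
  by_contra hK
  have hD : 0 ≤ D := (ContinuousLinearMap.opNorm_nonneg (P 0)).trans (hPD 0)
  obtain ⟨y, μ, Q, hy, hμ, hμy, hQ1, hQlim, hhead, hself⟩ := exists_adapted_pairs K J P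
  obtain ⟨U, hU, hPU⟩ := hJP y hy
  have hμP : ∀ n F, ‖μ n (P n F)‖ ≤ D * ‖F‖ := fun n F => by
    have h := ContinuousLinearMap.le_of_opNorm_le_of_le (μ n) (hμ n)
      (ContinuousLinearMap.le_of_opNorm_le (P n) (hPD n) F)
    rwa [one_mul] at h
  let ρ : ℕ → ℕ → EllInfty ℝ →L[ℝ] ℝ := fun m n =>
    (μ n).comp ((P n).comp ((Q m).comp U))
  have hρ : ∀ m n, ‖ρ m n‖ ≤ D * ‖U‖ := fun m n =>
    ContinuousLinearMap.opNorm_le_bound _ (by positivity) fun a => by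
      rw [mul_assoc]
      refine (hμP _ _).trans (mul_le_mul_of_nonneg_left ?_ hD)
      have h := ContinuousLinearMap.le_of_opNorm_le_of_le (Q m) (hQ1 m) (U.le_opNorm a)
      rwa [one_mul] at h
  let R : K → K → Prop := fun s t => ∀ k, J k (y k) s = J k (y k) t
  -- Since `m` is chosen only after `A`, the Rosenthal bound is imposed for every `m`, together with
  -- small oscillation for every coordinate and every tolerance `1 / (p + 1)`.
  let Φ : ℕ ⊕ ℕ × ℕ → Set ℕ → Prop := Sum.elim
    (fun m A => ∀ n ∈ A, ‖(ρ m n).comp (EllInfty.pull (A \ {n}) id)‖ ≤ 1 / 4)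
    (fun c A => ∀ B ⊆ A, ∀ s t, R s t →
      |U (EllInfty.ind B) s c.1 - U (EllInfty.ind B) t c.1| ≤ 1 / ((c.2 : ℝ) + 1))
  obtain ⟨A, hAi, hA⟩ := EllInfty.exists_infinite_forall_diff_finite (Φ := Φ)
    (by
      rintro (m | c) A B hBA h
      · exact fun n hn => (EllInfty.norm_comp_pull_id_mono _
          (Set.sdiff_subset_sdiff_left hBA)).trans (h n (hBA hn))
      · exact fun B' hB' => h B' (hB'.trans hBA))
    (by
      rintro (m | c) M hM
      · exact EllInfty.exists_infinite_norm_comp_pull_le (hρ m) (by norm_num) hM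
      · exact exists_infinite_subset_oscillation_le hK U R c.1 (by positivity) hM)
  -- Finite modifications of `A` do no harm: the removed terms `J k (y k)` agree at `R`-related
  -- points by definition of `R`.
  have hfactor : ∀ s t, R s t → U (EllInfty.ind A) s = U (EllInfty.ind A) t := by
    intro s t hst
    apply lp.ext
    funext l
    rw [← sub_eq_zero, ← abs_eq_zero]
    refine le_antisymm ?_ (abs_nonneg _)
    refine ge_of_tendsto' tendsto_one_div_add_atTop_nhds_zero_nat fun p => ?_
    obtain ⟨F, hF⟩ := hA (Sum.inr (l, p))
    have h := hF _ subset_rfl s t hst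
    have hfin : (∑ k ∈ F with k ∈ A, U (EllInfty.ind {k})) s =
        (∑ k ∈ F with k ∈ A, U (EllInfty.ind {k})) t := by
      rw [ContinuousMap.sum_apply, ContinuousMap.sum_apply]
      exact Finset.sum_congr rfl fun k _ => by rw [hU]; exact hst k
    rw [EllInfty.ind_eq_ind_diff_add A F, map_add, map_sum, ContinuousMap.add_apply,
      ContinuousMap.add_apply, hfin, lp.coeFn_add, lp.coeFn_add, Pi.add_apply, Pi.add_apply,
      add_sub_add_right_eq_sub]
    exact h
  obtain ⟨m, hm⟩ := (Metric.tendsto_atTop.1 (hQlim _ hfactor) (1 / (4 * (D + 1)))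
    (by positivity)).imp fun m h => h m le_rfl
  obtain ⟨F, hF⟩ := hA (Sum.inl m)
  have hsmall : Tendsto (fun n => ρ m n (EllInfty.ind {n}) +
      ∑ k ∈ F with k ∈ A, ρ m n (EllInfty.ind {k})) atTop (𝓝 0) := by
    have h1 : Tendsto (fun n => ρ m n (EllInfty.ind {n})) atTop (𝓝 0) :=
      (hself m).congr fun n => by rw [← hU]; rfl
    have h2 : ∀ k, Tendsto (fun n => ρ m n (EllInfty.ind {k})) atTop (𝓝 0) := fun k =>
      (hhead m k).congr fun n => by rw [← hU]; rfl
    simpa using h1.add (tendsto_finsetSum (F.filter (· ∈ A)) fun k _ => h2 k)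
  obtain ⟨N, hN⟩ := Metric.tendsto_atTop.1 hsmall (1 / 4) (by norm_num)
  obtain ⟨n, hnA, hn⟩ := hAi.exists_gt (max N (F.sup id))
  rw [max_lt_iff] at hn
  have hnAF : n ∈ A \ (F : Set ℕ) :=
    ⟨hnA, fun h => absurd hn.2 (not_lt.2 (Finset.le_sup (f := id) h))⟩
  have hoff : |ρ m n (EllInfty.ind ((A \ F) \ {n}))| ≤ 1 / 4 * 1 := by
    have h := ContinuousLinearMap.le_of_opNorm_le_of_le _ (hF n hnAF)
      (EllInfty.norm_ind_le ((A \ F) \ {n}))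
    rwa [ContinuousLinearMap.comp_apply, EllInfty.pull_id_ind, Set.inter_self] at h
  have hdec : ρ m n (EllInfty.ind A) = ρ m n (EllInfty.ind ((A \ F) \ {n})) +
      (ρ m n (EllInfty.ind {n}) + ∑ k ∈ F with k ∈ A, ρ m n (EllInfty.ind {k})) := by
    rw [EllInfty.ind_eq_ind_diff_add A F, map_add, map_sum, ← add_assoc,
      ← map_add (ρ m n) (EllInfty.ind ((A \ F) \ {n})), ← EllInfty.ind_union
        Set.disjoint_sdiff_left, Set.sdiff_union_of_subset (by simpa using hnAF)]
  have happrox : |ρ m n (EllInfty.ind A) - 1| ≤ 1 / 4 := by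
    have h1 : (1 : ℝ) = μ n (P n (U (EllInfty.ind A))) := by
      rw [hPU, EllInfty.ind_apply, if_pos hnA, one_smul, hμy]
    have h2 : ρ m n (EllInfty.ind A) - 1 =
        μ n (P n (Q m (U (EllInfty.ind A)) - U (EllInfty.ind A))) := by
      rw [map_sub, map_sub, ← h1]
      rfl
    rw [h2]
    refine (hμP _ _).trans ?_
    rw [dist_eq_norm, lt_div_iff₀ (by positivity)] at hm
    nlinarith [norm_nonneg (Q m (U (EllInfty.ind A)) - U (EllInfty.ind A))]
  have hn' := hN n hn.1.le
  rw [Real.dist_eq, sub_zero] at hn'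
  rw [hdec] at happrox
  -- The value is at least `3 / 4` by approximation, yet less than `1 / 4 + 1 / 4` by the
  -- decomposition.
  linarith [(abs_le.1 happrox).1, (abs_le.1 hoff).2, (abs_lt.1 hn').2]

/-- `ℓ_∞` does not embed into a separable space. -/
theorem not_linearlyEmbeds_of_separableSpace {Z : Type*} [NormedAddCommGroup Z] [NormedSpace ℝ Z]
    [TopologicalSpace.SeparableSpace Z] : ¬ LinearlyEmbeds (EllInfty ℝ) Z := by
  classical
  rintro ⟨T, c, hc, hT⟩
  -- The indicators of all subsets of `ℕ` have `c`-separated images: uncountably many disjoint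
  -- balls.
  have hsep : ∀ A B : Set ℕ, A ≠ B → c ≤ dist (T (EllInfty.ind A)) (T (EllInfty.ind B)) := by
    intro A B hAB
    obtain ⟨n, hn⟩ : ∃ n, ¬ (n ∈ A ↔ n ∈ B) := by
      by_contra! h
      exact hAB (Set.ext h)
    have h1 : 1 ≤ ‖EllInfty.ind A - EllInfty.ind B‖ := by
      refine le_trans ?_ (EllInfty.norm_coord_le _ n)
      rw [lp.coeFn_sub, Pi.sub_apply, EllInfty.ind_apply, EllInfty.ind_apply]
      by_cases hA : n ∈ A <;> by_cases hB : n ∈ B <;> simp_all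
    have h2 := hT (EllInfty.ind A - EllInfty.ind B)
    rw [dist_eq_norm, ← map_sub]
    nlinarith
  have hdisj : Pairwise (Function.onFun Disjoint
      fun A : Set ℕ => Metric.ball (T (EllInfty.ind A)) (c / 2)) := by
    intro A B hAB
    exact Metric.ball_disjoint_ball (by linarith [hsep A B hAB])
  have hcount := Set.PairwiseDisjoint.countable_of_isOpen (a := Set.univ)
    (s := fun A : Set ℕ => Metric.ball (T (EllInfty.ind A)) (c / 2))
    (fun A _ B _ hAB => hdisj hAB) (fun _ _ => Metric.isOpen_ball)
    (fun A _ => Metric.nonempty_ball.2 (half_pos hc))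
  have : Countable (Set ℕ) := Set.countable_univ_iff.1 hcount
  obtain ⟨e, he⟩ := exists_surjective_nat (Set ℕ)
  exact Function.cantor_surjective e he

end Main

theorem theorem5p1 (K : Type*) [TopologicalSpace K] [CompactSpace K] [T2Space K] [Infinite K] :
    (LinearlyIsomorphic C(K, EllInfty ℝ) (EllInfty C(K, ℝ)) →
      LinearlyEmbeds (EllInfty ℝ) C(K, ℝ)) ∧
    (TopologicalSpace.MetrizableSpace K →
      ¬ LinearlyIsomorphic C(K, EllInfty ℝ) (EllInfty C(K, ℝ))) := by
  have hembeds : LinearlyIsomorphic C(K, EllInfty ℝ) (EllInfty C(K, ℝ)) →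
      LinearlyEmbeds (EllInfty ℝ) C(K, ℝ) := by
    intro h
    obtain ⟨J, P, D, hPD, hJP⟩ := h.exists_diagonal_operators
    exact linearlyEmbeds_of_diagonal_operators J P hPD hJP
  refine ⟨hembeds, fun hK h => ?_⟩
  -- For compact metric `K` the space `C(K)` is separable.
  let _ := TopologicalSpace.metrizableSpaceMetric K
  exact not_linearlyEmbeds_of_separableSpace (hembeds h)
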